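/- Let $n\ge 1$. Cars numbered $1,\dots,n$ arrive one at a time, in this order, at a one-way street with spaces $1,\dots,n$; car $i$ has a preferred space $\pi_i\in[n]$ and parks in the first free space among $\pi_i,\pi_i+1,\dots,n$, or leaves the street if there is none. The sequence $\pi=(\pi_1,\dots,\pi_n)$ is a parking function if all cars are able to park, and then it yields a permutation $\sigma=T_n(\pi)\in S_n$, where $\sigma_k$ is the number of the car that parked in space $k$. Let $P_n^{\text{park}}$ be the distribution on $S_n$ of $T_n(\pi)$ when $\pi$ is a uniformly random parking function, let $E_n^{\text{park}}$ be the corresponding expectation, and let $X_n^{\text{LR-max}}(\sigma)$ be the number of left-to-right maxima of $\sigma$, that is, the number of $i\in[n]$ such that $\sigma_i>\sigma_k$ for all $k<i$. (i) For every $n\ge1$, $$E_n^{\text{park}}X_n^{\text{LR-max}}=n-\sum_{l=1}^n\frac{n-l}{l(l+1)}\,\frac{\prod_{j=0}^{l-1}(n-j)}{(n+1)^l}.$$ (ii) $$\limsup_{n\to\infty}\frac{E_n^{\text{park}}X_n^{\text{LR-max}}}{n^{\frac12+\epsilon}}=0\quad\text{for every }\epsilon>0,\qquad \liminf_{n\to\infty}\frac{E_n^{\text{park}}X_n^{\text{LR-max}}}{n^{\frac12}}>0.$$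 -/

import Mathlib

noncomputable section

/-!  Cars and parking spaces are both indexed by `Fin n`, i.e. numbered from `0` to `n - 1` instead of
from `1` to `n`. A state of the street is a map `Fin n → Option (Fin n)` which tells, for each space,
which car (if any) is parked in it. -/

namespace Parking

/-- The spaces in which a car with preferred space `p` may park: the free spaces from `p` onwards. -/
def available {n : ℕ} (s : Fin n → Option (Fin n)) (p : Fin n) : Finset (Fin n) :=
  Finset.univ.filter (fun k => p ≤ k ∧ s k = none)

/-- Car `i` with preferred space `p` arrives: it parks in the first available space from `p` onwards;
if there is none, it exits the street. -/
def park {n : ℕ} (s : Fin n → Option (Fin n)) (i p : Fin n) : Fin n → Option (Fin n) :=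
  if h : (available s p).Nonempty then
    Function.update s ((available s p).min' h) (some i)
  else s

/-- The state of the street after the first `m` cars have arrived, in order, with preferences `π`. -/
def street {n : ℕ} (π : Fin n → Fin n) : ℕ → Fin n → Option (Fin n)
  | 0 => fun _ => none
  | m + 1 => if h : m < n then park (street π m) ⟨m, h⟩ (π ⟨m, h⟩) else street π m

/-- `π` is a parking function if all `n` cars are able to park. -/
def IsParkingFunction {n : ℕ} (π : Fin n → Fin n) : Prop :=
  ∀ i : Fin n, ∃ k : Fin n, street π n k = some i

instance {n : ℕ} : DecidablePred (IsParkingFunction (n := n)) := fun π => by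
  unfold IsParkingFunction
  infer_instance

/-- The set of parking functions on `n` spaces. -/
abbrev ParkingFunction (n : ℕ) : Type := {π : Fin n → Fin n // IsParkingFunction π}

theorem exists_perm {n : ℕ} {π : Fin n → Fin n} (hπ : IsParkingFunction π) :
    ∃ σ : Equiv.Perm (Fin n), ∀ k, street π n k = some (σ k) := by
  choose g hg using hπ
  have hinj : Function.Injective g := by
    intro a b hab
    have h := hg a
    rw [hab, hg b] at h
    exact (Option.some.inj h).symm
  refine ⟨(Equiv.ofBijective g (Finite.injective_iff_bijective.mp hinj)).symm, fun k => ?_⟩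
  obtain ⟨i, rfl⟩ := (Finite.injective_iff_bijective.mp hinj).2 k
  rw [hg i, Equiv.ofBijective_symm_apply_apply]

/-- The map from parking functions to permutations: `toPerm π k` is the car that parked in space `k`. -/
def toPerm {n : ℕ} (π : ParkingFunction n) : Equiv.Perm (Fin n) :=
  Classical.choose (exists_perm π.2)

theorem street_eq_toPerm {n : ℕ} (π : ParkingFunction n) (k : Fin n) :
    street π.1 n k = some (toPerm π k) :=
  Classical.choose_spec (exists_perm π.2) k

theorem street_id {n : ℕ} (m : ℕ) (hm : m ≤ n) (k : Fin n) :
    street (fun i : Fin n => i) m k = if (k : ℕ) < m then some k else none := by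
  induction m generalizing k with
  | zero => simp [street]
  | succ m ih =>
    have hmn : m < n := hm
    have ih' := fun k => ih hmn.le k
    have hmem : (⟨m, hmn⟩ : Fin n) ∈
        available (street (fun i : Fin n => i) m) ⟨m, hmn⟩ := by
      simp [available, ih']
    have hne : (available (street (fun i : Fin n => i) m) ⟨m, hmn⟩).Nonempty := ⟨_, hmem⟩
    have hmin : (available (street (fun i : Fin n => i) m) ⟨m, hmn⟩).min' hne = ⟨m, hmn⟩ := by
      apply le_antisymm
      · exact Finset.min'_le _ _ hmem
      · apply Finset.le_min'
        intro y hy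
        exact (Finset.mem_filter.mp hy).2.1
    simp only [street, hmn, dif_pos, park, hne, hmin]
    by_cases hk : k = ⟨m, hmn⟩
    · subst hk
      simp
    · have hk' : (k : ℕ) ≠ m := fun h => hk (Fin.ext h)
      rw [Function.update_of_ne hk, ih']
      have : ((k : ℕ) < m) ↔ ((k : ℕ) < m + 1) := by omega
      simp only [this]

instance (n : ℕ) : Nonempty (ParkingFunction n) :=
  ⟨⟨fun i => i, fun i => ⟨i, by simp [street_id n le_rfl]⟩⟩⟩

/-- The distribution on permutations induced by a uniformly random parking function. -/
def parkPMF (n : ℕ) : PMF (Equiv.Perm (Fin n)) :=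
  (PMF.uniformOfFintype (ParkingFunction n)).map toPerm

/-- The expectation of a real random variable under the distribution `parkPMF n`. -/
def parkExpectation (n : ℕ) (X : Equiv.Perm (Fin n) → ℝ) : ℝ :=
  ∑ σ : Equiv.Perm (Fin n), (parkPMF n σ).toReal * X σ

/-- Position `i` is a left-to-right maximum of `σ`. -/
def IsLRMax {n : ℕ} (σ : Equiv.Perm (Fin n)) (i : Fin n) : Prop :=
  ∀ k : Fin n, k < i → σ k < σ i

instance {n : ℕ} (σ : Equiv.Perm (Fin n)) : DecidablePred (IsLRMax σ) := fun i => by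
  unfold IsLRMax
  infer_instance

/-- The total number of left-to-right maxima of `σ`. -/
def lrMax {n : ℕ} (σ : Equiv.Perm (Fin n)) : ℕ :=
  (Finset.univ.filter (fun i => IsLRMax σ i)).card

/-- The expected number of left-to-right maxima under `parkPMF n`. -/
def expectedLRMax (n : ℕ) : ℝ :=
  parkExpectation n (fun σ => (lrMax σ : ℝ))

end Parking

end

/-! A car ends in space `k` exactly when its preference is at most `k` and every space from the
preference up to `k - 1` holds an earlier car. Given the outcome `σ`, these conditions are
independent over the cars, so the fibre of `toPerm` over `σ` has size `∏ k, prefCount σ k`, where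
each factor is one plus the length of the run of smaller entries just left of `k`
(`card_fiber_toPerm`).

Cut `σ` at its largest entry. The product splits into the weights of the left part (size `k`) and
the right part, times `k + 1`; the left-to-right maxima are those of the left part plus the cut
entry. Hence the total weight `a` and the total weighted number of maxima `b` depend only on the
length, with `a (n+1) = ∑ C(n,k) (k+1) a k a (n-k)` and `b (n+1) = ∑ C(n,k) (k+1) (a k + b k) a
(n-k)`. Abel's binomial identity shows that `cayley` and `lrMaxTotal` satisfy these recurrences
(`sum_weight_and_recordCount`).

The expectation `b n / a n` is therefore `∑ (l+1)/l * r l` with `r = fallRatio n`. Two telescoping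
sums finish the proof: one converts this into the stated closed form, the other gives `∑ (l+1) * r l
= n`, which bounds the part of the sum beyond `√n`. For `l ≤ √n` the ratios `r l` are bounded below,
so the sum has order `√n`. -/

noncomputable section

namespace Parking

open Finset

/-! ### Abel's binomial identity -/

/-- The number `(k + 1) ^ (k - 1)` of parking functions of length `k`, as a real number. -/
def cayley (k : ℕ) : ℝ := ((k : ℝ) + 1) ^ (k - 1)

theorem succ_mul_cayley (k : ℕ) : ((k : ℝ) + 1) * cayley k = ((k : ℝ) + 1) ^ k := by
  rcases k with _ | k
  · simp [cayley]
  · rw [cayley, Nat.add_sub_cancel, pow_succ']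

theorem cayley_pos (k : ℕ) : 0 < cayley k := by unfold cayley; positivity

/-- This is the `m`-th finite difference, taken at `1`, of a power of degree `m - 1`. -/
theorem alternating_sum_choose_pow (m : ℕ) (hm : 0 < m) :
    ∑ k ∈ range (m + 1), (m.choose k : ℝ) * (-1) ^ (m - k) * ((k : ℝ) + 1) ^ (m - 1) = 0 := by
  have h := congrFun (fwdDiff_iter_pow_eq_zero_of_lt (R := ℝ) (j := m - 1) (n := m) (by omega)) 1
  rw [fwdDiff_iter_eq_sum_shift] at h
  rw [Pi.zero_apply] at h
  rw [← h]
  refine sum_congr rfl fun k _ => ?_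
  simp only [zsmul_eq_mul, nsmul_eq_mul]
  push_cast
  ring

/-- At `x = -1 - m` the Abel base is `-(k + 1)`, so the exponents `k - 1` and `m - k` merge. For `k
= 0` the truncated exponent is harmless because the base is `1`. -/
theorem cayley_mul_pow {m k : ℕ} (hk : k ≤ m) (hm : 0 < m) :
    cayley k * (-1 - (m : ℝ) + ((m - k : ℕ) : ℝ)) ^ (m - k) =
      (-1) ^ (m - k) * ((k : ℝ) + 1) ^ (m - 1) := by
  have h : -1 - (m : ℝ) + ((m - k : ℕ) : ℝ) = (-1) * ((k : ℝ) + 1) := by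
    rw [Nat.cast_sub hk]; ring
  rw [h, mul_pow, mul_left_comm, cayley]
  rcases k with _ | k
  · simp
  · rw [← pow_add]
    congr 2
    omega

/-- Abel's binomial identity. -/
theorem abel_identity (m : ℕ) (x : ℝ) :
    ∑ k ∈ range (m + 1), (m.choose k : ℝ) * cayley k * (x + ((m - k : ℕ) : ℝ)) ^ (m - k) =
      (x + 1 + m) ^ m := by
  induction m generalizing x with
  | zero => simp [cayley]
  | succ m ih =>
    set f : ℝ → ℝ := fun x => ∑ k ∈ range (m + 1 + 1), ((m + 1).choose k : ℝ) * cayley k *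
      (x + ((m + 1 - k : ℕ) : ℝ)) ^ (m + 1 - k) - (x + 1 + (m + 1 : ℕ)) ^ (m + 1) with hf
    -- Differentiating both sides gives `m + 1` times the identity for `m` at `x + 1`, so the
    -- difference `f` is constant.
    have hder : ∀ x, HasDerivAt f 0 x := by
      intro x
      have h1 : HasDerivAt f (∑ k ∈ range (m + 1 + 1), ((m + 1).choose k : ℝ) * cayley k *
          (((m + 1 - k : ℕ) : ℝ) * (x + ((m + 1 - k : ℕ) : ℝ)) ^ (m + 1 - k - 1) * 1) -
          ((m + 1 : ℕ) : ℝ) * (x + 1 + (m + 1 : ℕ)) ^ (m + 1 - 1) * 1) x := by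
        refine HasDerivAt.sub (HasDerivAt.fun_sum fun k _ => ?_) ?_
        · exact (((hasDerivAt_id x).add_const _).pow _).const_mul _
        · exact (((hasDerivAt_id x).add_const _).add_const _).pow _
      convert h1 using 1
      rw [sum_range_succ, Nat.sub_self, Nat.cast_zero, zero_mul, zero_mul, mul_zero, add_zero,
        eq_comm, sub_eq_zero]
      have h2 := ih (x + 1)
      rw [Nat.add_sub_cancel]
      have h3 : x + 1 + ((m + 1 : ℕ) : ℝ) = x + 1 + 1 + m := by push_cast; ring
      rw [h3, ← h2, mul_one, mul_sum]
      refine sum_congr rfl fun k hk => ?_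
      have hk' : k ≤ m := Nat.lt_succ_iff.mp (mem_range.mp hk)
      have h4 : m + 1 - k = (m - k) + 1 := by omega
      have h5 : ((m + 1).choose k : ℝ) * ((m - k : ℕ) + 1) = (m + 1) * m.choose k := by
        have := Nat.choose_mul_succ_eq m k
        rw [h4] at this
        have h6 : (m.choose k : ℝ) * (m + 1) = (m + 1).choose k * ((m - k : ℕ) + 1) := by
          exact_mod_cast this
        linarith
      rw [h4, Nat.add_sub_cancel]
      push_cast
      have h7 : x + (((m - k : ℕ) : ℝ) + 1) = x + 1 + ((m - k : ℕ) : ℝ) := by ring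
      rw [h7]
      linear_combination cayley k * (x + 1 + ((m - k : ℕ) : ℝ)) ^ (m - k) * h5
    have hconst : f x = f (-1 - ((m + 1 : ℕ) : ℝ)) :=
      is_const_of_deriv_eq_zero (fun x => (hder x).differentiableAt) (fun x => (hder x).deriv) _ _
    -- At this point the right-hand side vanishes and the left-hand side becomes the alternating sum
    -- above.
    have hzero : f (-1 - ((m + 1 : ℕ) : ℝ)) = 0 := by
      have h0 : -1 - ((m + 1 : ℕ) : ℝ) + 1 + ((m + 1 : ℕ) : ℝ) = 0 := by ring
      simp only [hf]
      rw [h0, zero_pow (Nat.succ_ne_zero m), sub_zero,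
        ← alternating_sum_choose_pow (m + 1) (Nat.succ_pos m)]
      refine sum_congr rfl fun k hk => ?_
      rw [mul_assoc, mul_assoc,
        cayley_mul_pow (Nat.lt_succ_iff.mp (mem_range.mp hk)) (Nat.succ_pos m)]
    exact sub_eq_zero.mp (hconst.trans hzero)

theorem sum_choose_pow_mul_cayley (m : ℕ) (x : ℝ) :
    ∑ j ∈ range (m + 1), (m.choose j : ℝ) * (x + j) ^ j * cayley (m - j) = (x + 1 + m) ^ m := by
  rw [← abel_identity, ← sum_range_reflect]
  refine sum_congr rfl fun k hk => ?_
  have hk' : k ≤ m := Nat.lt_succ_iff.mp (mem_range.mp hk)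
  rw [Nat.add_sub_cancel, Nat.choose_symm hk', Nat.sub_sub_self hk']
  ring

/-! ### Convolutions with falling factorials, and the two recurrences. -/

theorem choose_mul_descFactorial (l m j : ℕ) :
    (l + m).choose (l + j) * (l + j).descFactorial l = (l + m).descFactorial l * m.choose j := by
  rw [Nat.descFactorial_eq_factorial_mul_choose, Nat.descFactorial_eq_factorial_mul_choose]
  rcases le_or_gt j m with hj | hj
  · have := Nat.choose_mul (n := l + m) (k := l + j) (s := l) (by omega)
    rw [Nat.add_sub_cancel_left, Nat.add_sub_cancel_left] at this
    linear_combination l.factorial * this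
  · rw [Nat.choose_eq_zero_of_lt hj, Nat.choose_eq_zero_of_lt (by omega)]
    simp

/-- Terms with `k < l` vanish. For `k = l + j`, pulling the falling factorial out of the binomial
coefficient leaves Abel's identity for `m = n - l` at `x = l + 1`. -/
theorem sum_choose_descFactorial {n l : ℕ} (hl : l ≤ n) :
    ∑ k ∈ range (n + 1), (n.choose k : ℝ) * k.descFactorial l * ((k : ℝ) + 1) ^ (k - l) *
      cayley (n - k) = n.descFactorial l * ((n : ℝ) + 2) ^ (n - l) := by
  obtain ⟨m, rfl⟩ := Nat.exists_eq_add_of_le hl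
  rw [add_assoc, sum_range_add, sum_eq_zero, zero_add, Nat.add_sub_cancel_left]
  · have h := sum_choose_pow_mul_cayley m (l + 1)
    have h2 : ((l + m : ℕ) : ℝ) + 2 = l + 1 + 1 + m := by push_cast; ring
    rw [h2, ← h, mul_sum]
    refine sum_congr rfl fun j _ => ?_
    have h3 : (((l + m).choose (l + j) : ℕ) : ℝ) * (l + j).descFactorial l =
        (l + m).descFactorial l * m.choose j := by exact_mod_cast choose_mul_descFactorial l m j
    rw [h3, Nat.add_sub_cancel_left, Nat.add_sub_add_left]
    push_cast
    ring
  · intro k hk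
    rw [Nat.descFactorial_of_lt (mem_range.mp hk)]
    simp

/-- The total number of left-to-right maxima over all parking functions of length `k`. -/
def lrMaxTotal (k : ℕ) : ℝ :=
  ∑ l ∈ Icc 1 k, ((l : ℝ) + 1) / l * k.descFactorial l * ((k : ℝ) + 1) ^ (k - l) / (k + 1)

/-- The case `l = 0` of the preceding convolution. -/
theorem cayley_recurrence (n : ℕ) :
    ∑ k ∈ range (n + 1), (n.choose k : ℝ) * (((k : ℝ) + 1) * cayley k * cayley (n - k)) =
      cayley (n + 1) := by
  have h := sum_choose_descFactorial (Nat.zero_le n)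
  simp only [Nat.descFactorial_zero, Nat.cast_one, mul_one, Nat.sub_zero, one_mul] at h
  rw [cayley, Nat.add_sub_cancel]
  push_cast
  rw [add_assoc, one_add_one_eq_two, ← h]
  refine sum_congr rfl fun k _ => ?_
  rw [succ_mul_cayley]
  ring

/-- Telescopes: after shifting the index, `l + 2 = (n + 2) - (n - l)`, and the factor `n - l`
extends the falling factorial by one step. -/
theorem sum_succ_mul_descFactorial (n : ℕ) :
    ∑ l ∈ Icc 1 (n + 1), ((l : ℝ) + 1) * n.descFactorial (l - 1) * ((n : ℝ) + 2) ^ (n + 1 - l) =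
      ((n : ℝ) + 2) ^ (n + 1) := by
  have h : ∀ l ∈ range (n + 1),
      (((l + 1 : ℕ) : ℝ) + 1) * n.descFactorial l * ((n : ℝ) + 2) ^ (n - l) =
        n.descFactorial l * ((n : ℝ) + 2) ^ (n + 1 - l) -
          n.descFactorial (l + 1) * ((n : ℝ) + 2) ^ (n + 1 - (l + 1)) := by
    intro l hl
    have hl' : l ≤ n := Nat.lt_succ_iff.mp (mem_range.mp hl)
    rw [Nat.descFactorial_succ, Nat.add_sub_add_right, Nat.succ_sub hl', pow_succ]
    push_cast [Nat.cast_sub hl']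
    ring
  rw [← Ico_add_one_right_eq_Icc, sum_Ico_eq_sum_range]
  simp only [Nat.add_sub_cancel, add_comm 1]
  simp only [Nat.add_sub_add_right]
  rw [sum_congr rfl h, sum_range_sub']
  simp

/-- After multiplication by `n + 2`, the `cayley` part is `(n + 2) ^ (n + 1)`, expanded by the
telescoping sum above, and the `lrMaxTotal` part is evaluated by the convolution for each `l`. The
two expansions add up term by term through `(n+1)_l = n_l + l * n_(l-1)` for falling factorials. -/
theorem lrMaxTotal_recurrence (n : ℕ) :
    ∑ k ∈ range (n + 1),
      (n.choose k : ℝ) * (((k : ℝ) + 1) * (cayley k + lrMaxTotal k) * cayley (n - k)) =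
      lrMaxTotal (n + 1) := by
  have h1 : ∀ k ∈ range (n + 1), ((k : ℝ) + 1) * lrMaxTotal k =
      ∑ l ∈ Icc 1 n, ((l : ℝ) + 1) / l * k.descFactorial l * ((k : ℝ) + 1) ^ (k - l) := by
    intro k hk
    have hk' : k ≤ n := Nat.lt_succ_iff.mp (mem_range.mp hk)
    have hpos : (k : ℝ) + 1 ≠ 0 := by positivity
    rw [lrMaxTotal, mul_sum]
    -- The range of `l` is made independent of `k`, so that the sums can be exchanged; the added
    -- falling factorials are zero.
    refine sum_subset_zero_on_sdiff (Icc_subset_Icc_right hk') ?_ fun l _ => ?_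
    · intro l hl
      simp only [mem_sdiff, mem_Icc] at hl
      rw [Nat.descFactorial_of_lt (by omega)]
      simp
    · field_simp
  have h2 : ∑ k ∈ range (n + 1), (n.choose k : ℝ) * (((k : ℝ) + 1) * lrMaxTotal k * cayley (n - k)) =
      ∑ l ∈ Icc 1 n, ((l : ℝ) + 1) / l * (n.descFactorial l * ((n : ℝ) + 2) ^ (n - l)) := by
    rw [sum_congr rfl fun k hk => by rw [h1 k hk, sum_mul, mul_sum], sum_comm]
    refine sum_congr rfl fun l hl => ?_
    rw [← sum_choose_descFactorial (mem_Icc.mp hl).2, mul_sum]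
    refine sum_congr rfl fun k _ => ?_
    ring
  have hn : (n : ℝ) + 2 ≠ 0 := by positivity
  have h3 := sum_succ_mul_descFactorial n
  have h4 : ((n : ℝ) + 2) * lrMaxTotal (n + 1) = ∑ l ∈ Icc 1 (n + 1), ((l : ℝ) + 1) / l *
      (n + 1).descFactorial l * ((n : ℝ) + 2) ^ (n + 1 - l) := by
    rw [lrMaxTotal, mul_sum]
    refine sum_congr rfl fun l _ => ?_
    have h5 : ((n + 1 : ℕ) : ℝ) + 1 = n + 2 := by push_cast; ring
    rw [h5]
    field_simp
  have h6 : ∑ l ∈ Icc 1 n, ((l : ℝ) + 1) / l * (n.descFactorial l * ((n : ℝ) + 2) ^ (n - l)) *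
      (n + 2) = ∑ l ∈ Icc 1 (n + 1), ((l : ℝ) + 1) / l * n.descFactorial l *
        ((n : ℝ) + 2) ^ (n + 1 - l) := by
    rw [sum_Icc_succ_top (by omega), Nat.descFactorial_of_lt (Nat.lt_succ_self n)]
    simp only [Nat.cast_zero, mul_zero, zero_mul, add_zero]
    refine sum_congr rfl fun l hl => ?_
    rw [Nat.succ_sub (mem_Icc.mp hl).2, pow_succ]
    ring
  have h7 : cayley (n + 1) * (n + 2) = ((n : ℝ) + 2) ^ (n + 1) := by
    have := succ_mul_cayley (n + 1)
    push_cast at this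
    rw [add_assoc, one_add_one_eq_two] at this
    rw [mul_comm, this]
  simp only [mul_add, add_mul, sum_add_distrib]
  have h8 := cayley_recurrence n
  simp only [mul_add, add_mul, sum_add_distrib] at h2 h8
  rw [h8, h2]
  refine mul_right_cancel₀ hn ?_
  rw [add_mul, sum_mul, h6, h7, mul_comm (lrMaxTotal (n + 1)), h4, ← h3, ← sum_add_distrib]
  refine sum_congr rfl fun l hl => ?_
  obtain ⟨k, rfl⟩ := Nat.exists_eq_add_of_le' (mem_Icc.mp hl).1
  have h9 : (n + 1).descFactorial (k + 1) = n.descFactorial (k + 1) + (k + 1) * n.descFactorial k := by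
    have hk : k ≤ n := by have := (mem_Icc.mp hl).2; omega
    rw [Nat.succ_descFactorial_succ, Nat.descFactorial_succ, ← add_mul]
    congr 1
    omega
  rw [h9, Nat.add_sub_cancel]
  have : ((k + 1 : ℕ) : ℝ) ≠ 0 := by positivity
  push_cast at this ⊢
  field_simp
  ring

section Arrangements

/-! ### Arrangements of a finite set, read from right to left -/

variable {α : Type*} [LinearOrder α]

/-- The number of ways to choose the preferences of the cars when the cars in the street, read from
right to left, are `w`. -/
def weight : List α → ℕ
  | [] => 1
  | x :: r => ((r.takeWhile (· < x)).length + 1) * weight r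

/-- The number of entries of a list that exceed all later entries. -/
def recordCount : List α → ℕ
  | [] => 0
  | x :: r => recordCount r + if ∀ y ∈ r, y < x then 1 else 0

/-- The entry `M` stops every run starting in `v`, while its own run is all of `u`. -/
theorem weight_append_cons (v u : List α) (M : α) (hv : ∀ x ∈ v, x < M) (hu : ∀ x ∈ u, x < M) :
    weight (v ++ M :: u) = weight v * ((u.length + 1) * weight u) := by
  induction v with
  | nil =>
    have : u.takeWhile (· < M) = u := List.takeWhile_eq_self_iff.mpr (by simpa using hu)
    simp [weight, this]
  | cons x v ih =>
    have hx : ¬ M < x := (hv x (by simp)).not_gt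
    have h1 : (v ++ M :: u).takeWhile (· < x) = v.takeWhile (· < x) := by
      clear ih hv
      induction v with
      | nil => simp [hx]
      | cons y v ih => simp only [List.cons_append, List.takeWhile_cons, ih]
    rw [List.cons_append, weight, weight, h1, ih fun y hy => hv y (by simp [hy])]
    ring

/-- No entry of `v` is a record, since the larger `M` comes later; `M` itself is one. -/
theorem recordCount_append_cons (v u : List α) (M : α) (hv : ∀ x ∈ v, x < M)
    (hu : ∀ x ∈ u, x < M) : recordCount (v ++ M :: u) = recordCount u + 1 := by
  induction v with
  | nil => simp [recordCount, if_pos hu]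
  | cons x v ih =>
    have h1 : ¬ ∀ y ∈ v ++ M :: u, y < x := fun h =>
      (h M (by simp)).not_gt (hv x (by simp))
    rw [List.cons_append, recordCount, if_neg h1, ih fun y hy => hv y (by simp [hy])]

/-- The lists enumerating a finite set without repetition. -/
def arrangements (S : Finset α) : Finset (List α) := S.val.lists.toFinset

theorem mem_arrangements {S : Finset α} {w : List α} :
    w ∈ arrangements S ↔ w.Nodup ∧ w.toFinset = S := by
  rw [arrangements, Multiset.mem_toFinset, Multiset.mem_lists_iff, Multiset.quot_mk_to_coe]
  constructor
  · intro h
    have hn : w.Nodup := by rw [← Multiset.coe_nodup, ← h]; exact S.nodup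
    refine ⟨hn, ?_⟩
    ext a
    rw [List.mem_toFinset, ← Multiset.mem_coe, ← h, mem_val]
  · rintro ⟨hn, rfl⟩
    rw [List.toFinset_val, hn.dedup]

/-- Cutting at the unique occurrence of `M` is a bijection; `A` is the set of entries after `M`,
which are the cars to its left in the street. -/
theorem sum_arrangements_split {S : Finset α} {M : α} (hM : M ∈ S) (g : List α → ℝ) :
    ∑ w ∈ arrangements S, g w = ∑ A ∈ (S.erase M).powerset, ∑ u ∈ arrangements A,
      ∑ v ∈ arrangements (S.erase M \ A), g (v ++ M :: u) := by
  simp_rw [sum_sigma']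
  symm
  refine sum_bij (fun x _ => x.2.2 ++ M :: x.2.1) ?_ ?_ ?_ fun _ _ => rfl
  · rintro ⟨A, u, v⟩ h
    simp only [mem_sigma, mem_powerset, mem_arrangements] at h ⊢
    obtain ⟨hA, ⟨hu, rfl⟩, hv, hvS⟩ := h
    have hmem : ∀ x, x ∈ v ↔ (x ≠ M ∧ x ∈ S) ∧ x ∉ u := fun x => by
      rw [← List.mem_toFinset, hvS]; simp
    have hA' : ∀ x ∈ u, x ≠ M ∧ x ∈ S := fun x hx => by
      simpa using hA (List.mem_toFinset.mpr hx)
    constructor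
    · rw [List.nodup_append, List.nodup_cons]
      refine ⟨hv, ⟨fun h => (hA' M h).1 rfl, hu⟩, ?_⟩
      rintro a ha b hb rfl
      rcases List.mem_cons.mp hb with rfl | hb
      · exact ((hmem _).mp ha).1.1 rfl
      · exact ((hmem _).mp ha).2 hb
    · ext x
      simp only [List.mem_toFinset, List.mem_append, List.mem_cons, hmem]
      constructor
      · rintro (h | rfl | h)
        · exact h.1.2
        · exact hM
        · exact (hA' x h).2
      · intro h
        by_cases h1 : x = M
        · exact Or.inr (Or.inl h1)
        by_cases h2 : x ∈ u
        · exact Or.inr (Or.inr h2)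
        · exact Or.inl ⟨⟨h1, h⟩, h2⟩
  · rintro ⟨A, u, v⟩ h ⟨A', u', v'⟩ h' heq
    simp only [mem_sigma, mem_powerset, mem_arrangements] at h h' heq
    obtain ⟨hA, ⟨hu, rfl⟩, hv, hvS⟩ := h
    obtain ⟨hA', ⟨hu', rfl⟩, hv', hvS'⟩ := h'
    have hMv : M ∉ v := fun h => by
      rw [← List.mem_toFinset, hvS] at h; simp at h
    have hMu : M ∉ u := fun h => by simpa using hA (List.mem_toFinset.mpr h)
    have key := (List.append_cons_inj_of_notMem hMv hMu).mp heq
    obtain ⟨rfl, -, rfl⟩ := key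
    rfl
  · intro w hw
    rw [mem_arrangements] at hw
    obtain ⟨hn, rfl⟩ := hw
    obtain ⟨v, u, rfl⟩ := List.append_of_mem (List.mem_toFinset.mp hM)
    rw [List.nodup_append, List.nodup_cons] at hn
    obtain ⟨hv, ⟨hMu, hu⟩, hd⟩ := hn
    refine ⟨⟨u.toFinset, u, v⟩, ?_, rfl⟩
    simp only [mem_sigma, mem_powerset, mem_arrangements]
    refine ⟨?_, ⟨hu, trivial⟩, hv, ?_⟩
    · intro x hx
      rw [List.mem_toFinset] at hx
      have : x ≠ M := by rintro rfl; exact hMu hx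
      simp [this, hx]
    · ext x
      simp only [List.mem_toFinset, mem_sdiff, mem_erase, List.mem_append, List.mem_cons]
      constructor
      · intro hx
        exact ⟨⟨hd x hx M (by simp), Or.inl hx⟩, fun h => hd x hx x (by simp [h]) rfl⟩
      · tauto

/-- Strong induction, cutting at the maximum of `S`. Arbitrary sets `S` are needed because the two
pieces are arrangements of arbitrary complementary subsets. -/
theorem sum_weight_and_recordCount (n : ℕ) : ∀ S : Finset α, S.card = n →
    ∑ w ∈ arrangements S, (weight w : ℝ) = cayley n ∧
      ∑ w ∈ arrangements S, (weight w : ℝ) * recordCount w = lrMaxTotal n := by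
  induction n using Nat.strong_induction_on with
  | _ n ih =>
    intro S hS
    rcases n with _ | n
    · rw [card_eq_zero] at hS
      subst hS
      have : arrangements (∅ : Finset α) = {[]} := by
        ext w
        rw [mem_arrangements]
        simp +contextual [List.toFinset_eq_empty_iff]
      rw [this]
      simp [weight, recordCount, cayley, lrMaxTotal]
    · have hne : S.Nonempty := card_pos.mp (by omega)
      set M := S.max' hne with hMdef
      have hM : M ∈ S := S.max'_mem hne
      have hcard : (S.erase M).card = n := by rw [card_erase_of_mem hM, hS]; rfl
      have hlt : ∀ x ∈ S.erase M, x < M := fun x hx =>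
        lt_of_le_of_ne (S.le_max' x (mem_of_mem_erase hx)) (ne_of_mem_erase hx)
      have facts : ∀ A ∈ (S.erase M).powerset, ∀ u ∈ arrangements A,
          ∀ v ∈ arrangements (S.erase M \ A),
          (weight (v ++ M :: u) : ℝ) = weight v * ((A.card + 1) * weight u) ∧
          (recordCount (v ++ M :: u) : ℝ) = recordCount u + 1 := by
        intro A hA u hu v hv
        rw [mem_powerset] at hA
        rw [mem_arrangements] at hu hv
        have hu' : ∀ x ∈ u, x < M := fun x hx =>
          hlt x (hA (by rw [← hu.2]; exact List.mem_toFinset.mpr hx))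
        have hv' : ∀ x ∈ v, x < M := fun x hx =>
          hlt x ((mem_sdiff.mp (by rw [← hv.2]; exact List.mem_toFinset.mpr hx)).1)
        have hlen : u.length = A.card := by rw [← hu.2, List.toFinset_card_of_nodup hu.1]
        rw [weight_append_cons v u M hv' hu', recordCount_append_cons v u M hv' hu', hlen]
        push_cast
        exact ⟨rfl, rfl⟩
      have hsub : ∀ A ∈ (S.erase M).powerset, A.card ≤ n ∧ (S.erase M \ A).card = n - A.card := by
        intro A hA
        rw [mem_powerset] at hA
        rw [card_sdiff_of_subset hA, hcard]
        exact ⟨hcard ▸ card_le_card hA, rfl⟩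
      constructor
      · rw [sum_arrangements_split hM, ← cayley_recurrence, ← hcard]
        trans ∑ A ∈ (S.erase M).powerset,
          ((A.card : ℝ) + 1) * cayley A.card * cayley ((S.erase M).card - A.card)
        · refine sum_congr rfl fun A hA => ?_
          obtain ⟨h1, h2⟩ := hsub A hA
          rw [sum_congr rfl fun u hu => sum_congr rfl fun v hv => (facts A hA u hu v hv).1]
          simp_rw [← sum_mul, ← mul_sum]
          rw [(ih _ (by omega) _ h2).1, (ih _ (by omega) A rfl).1, hcard]
          ring
        -- The summand depends only on the size of `A`; grouping by size produces the binomial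
        -- coefficients.
        · rw [sum_powerset_apply_card
            (fun k => ((k : ℝ) + 1) * cayley k * cayley ((S.erase M).card - k))]
          simp only [nsmul_eq_mul]
      · rw [sum_arrangements_split hM, ← lrMaxTotal_recurrence, ← hcard]
        trans ∑ A ∈ (S.erase M).powerset, ((A.card : ℝ) + 1) *
          (cayley A.card + lrMaxTotal A.card) * cayley ((S.erase M).card - A.card)
        · refine sum_congr rfl fun A hA => ?_
          obtain ⟨h1, h2⟩ := hsub A hA
          have h3 : ∀ u ∈ arrangements A, ∑ v ∈ arrangements (S.erase M \ A),
              (weight (v ++ M :: u) : ℝ) * recordCount (v ++ M :: u) =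
              cayley (n - A.card) * (A.card + 1) * (weight u * recordCount u + weight u) := by
            intro u hu
            rw [← (ih _ (by omega) _ h2).1, sum_mul, sum_mul]
            refine sum_congr rfl fun v hv => ?_
            rw [(facts A hA u hu v hv).1, (facts A hA u hu v hv).2]
            ring
          rw [sum_congr rfl h3, ← mul_sum, sum_add_distrib, (ih _ (by omega) A rfl).1,
            (ih _ (by omega) A rfl).2, hcard]
          ring
        · rw [sum_powerset_apply_card (fun k => ((k : ℝ) + 1) *
            (cayley k + lrMaxTotal k) * cayley ((S.erase M).card - k))]
          simp only [nsmul_eq_mul]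

end Arrangements

/-! ### Parking functions with a given outcome -/

/-- With preferences `p`, car `s k` parks in space `k`: its preference is at most `k`, and every space
from the preference up to `k` has been taken by an earlier car. -/
def HasOutcome {n : ℕ} (s : Equiv.Perm (Fin n)) (p : Fin n → Fin n) : Prop :=
  ∀ k, p (s k) ≤ k ∧ ∀ j, p (s k) ≤ j → j < k → s j < s k

theorem park_eq_some {n : ℕ} {s : Fin n → Option (Fin n)} {i p k c : Fin n}
    (h : park s i p k = some c) :
    s k = some c ∨ (c = i ∧ p ≤ k ∧ ∀ j, p ≤ j → j < k → s j ≠ none) := by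
  unfold park at h
  split_ifs at h with hne
  · by_cases hk : k = (available s p).min' hne
    · right
      rw [hk, Function.update_self] at h
      refine ⟨(Option.some.inj h).symm, ?_, fun j hpj hjk hj => ?_⟩
      · rw [hk]; exact (mem_filter.mp (min'_mem _ hne)).2.1
      · exact absurd (min'_le _ j (mem_filter.mpr ⟨mem_univ _, hpj, hj⟩)) (not_le.mpr (hk ▸ hjk))
    · left
      rwa [Function.update_of_ne hk] at h
  · exact Or.inl h

theorem park_of_eq_some {n : ℕ} {s : Fin n → Option (Fin n)} {i p k c : Fin n}
    (h : s k = some c) : park s i p k = some c := by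
  unfold park
  split_ifs with hne
  · have hk : k ≠ (available s p).min' hne := fun hk => by
      have := (mem_filter.mp (min'_mem _ hne)).2.2
      rw [← hk, h] at this
      exact absurd this (by simp)
    rw [Function.update_of_ne hk, h]
  · exact h

/-- Parked cars never move, and a car passes over a space only if an earlier car already occupies
it. -/
theorem street_invariant {n : ℕ} (p : Fin n → Fin n) (m : ℕ) (k i : Fin n)
    (h : street p m k = some i) :
    (i : ℕ) < m ∧ p i ≤ k ∧ ∀ j, p i ≤ j → j < k → ∃ c, c < i ∧ street p m j = some c := by
  induction m generalizing k i with
  | zero => simp [street] at h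
  | succ m ih =>
    by_cases hm : m < n
    · simp only [street, hm, dif_pos] at h ⊢
      rcases park_eq_some h with h | ⟨rfl, hpk, hj⟩
      · obtain ⟨h1, h2, h3⟩ := ih k i h
        refine ⟨by omega, h2, fun j hpj hjk => ?_⟩
        obtain ⟨c, hc, hs⟩ := h3 j hpj hjk
        exact ⟨c, hc, park_of_eq_some hs⟩
      · refine ⟨Nat.lt_succ_self m, hpk, fun j hpj hjk => ?_⟩
        obtain ⟨c, hc⟩ := Option.ne_none_iff_exists'.mp (hj j hpj hjk)
        exact ⟨c, (ih j c hc).1, park_of_eq_some hc⟩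
    · simp only [street, hm, dif_neg, not_false_eq_true] at h ⊢
      obtain ⟨h1, h2⟩ := ih k i h
      exact ⟨by omega, h2⟩

/-- When car `m` arrives, its target space is still free and all spaces between its preference and
the target hold smaller cars, so the target is the first available space. -/
theorem street_of_hasOutcome {n : ℕ} {s : Equiv.Perm (Fin n)} {p : Fin n → Fin n}
    (h : HasOutcome s p) (m : ℕ) (hm : m ≤ n) (k : Fin n) :
    street p m k = if (s k : ℕ) < m then some (s k) else none := by
  induction m generalizing k with
  | zero => simp [street]
  | succ m ih =>
    have hmn : m < n := hm
    have ih' := ih hmn.le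
    obtain ⟨k₀, hk₀⟩ := s.surjective ⟨m, hmn⟩
    have hval : (s k₀ : ℕ) = m := by rw [hk₀]
    obtain ⟨h1, h2⟩ := h k₀
    rw [hk₀] at h1 h2
    have hmem : k₀ ∈ available (street p m) (p ⟨m, hmn⟩) := by
      simp [available, h1, ih', hval]
    have hne : (available (street p m) (p ⟨m, hmn⟩)).Nonempty := ⟨_, hmem⟩
    have hmin : (available (street p m) (p ⟨m, hmn⟩)).min' hne = k₀ := by
      refine le_antisymm (min'_le _ _ hmem) (le_min' _ _ _ fun y hy => ?_)
      obtain ⟨-, hpy, hy⟩ := mem_filter.mp hy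
      by_contra hlt
      have h3 : (s y : ℕ) < m := h2 y hpy (not_le.mp hlt)
      rw [ih', if_pos h3] at hy
      exact absurd hy (by simp)
    simp only [street, hmn, dif_pos, park, hne, hmin]
    by_cases hk : k = k₀
    · subst hk
      simp [hk₀]
    · have hk' : (s k : ℕ) ≠ m := fun h => hk (s.injective (by rw [hk₀]; exact Fin.ext h))
      rw [Function.update_of_ne hk, ih']
      have : ((s k : ℕ) < m) ↔ ((s k : ℕ) < m + 1) := by omega
      simp only [this]

theorem street_eq_iff_hasOutcome {n : ℕ} (s : Equiv.Perm (Fin n)) (p : Fin n → Fin n) :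
    (∀ k, street p n k = some (s k)) ↔ HasOutcome s p := by
  constructor
  · intro h k
    obtain ⟨-, h1, h2⟩ := street_invariant p n k (s k) (h k)
    refine ⟨h1, fun j hpj hjk => ?_⟩
    obtain ⟨c, hc, hs⟩ := h2 j hpj hjk
    rw [h j] at hs
    rwa [Option.some.inj hs]
  · intro h k
    rw [street_of_hasOutcome h n le_rfl k, if_pos (s k).isLt]

/-- The number of preferences with which the car in space `k` ends up there, when `f j` is the car in
space `j`. -/
def prefCount {α : Type*} [LinearOrder α] {n : ℕ} (f : Fin n → α) (k : Fin n) : ℕ :=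
  (univ.filter fun p : Fin n => p ≤ k ∧ ∀ j, p ≤ j → j < k → f j < f k).card

/-- `HasOutcome` restricts each car's preference separately, so indexing preferences by final space
turns the fibre into a product of finite sets. Every element of that product is automatically a
parking function. -/
theorem card_fiber_toPerm {n : ℕ} (s : Equiv.Perm (Fin n)) :
    (univ.filter fun p : ParkingFunction n => toPerm p = s).card = ∏ k, prefCount s k := by
  have hiff : ∀ p : ParkingFunction n, toPerm p = s ↔ HasOutcome s p.1 := by
    intro p
    rw [← street_eq_iff_hasOutcome]
    constructor
    · rintro rfl k
      exact street_eq_toPerm p k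
    · intro h
      ext k
      have := (street_eq_toPerm p k).symm.trans (h k)
      rw [Option.some.inj this]
  unfold prefCount
  rw [← Fintype.card_piFinset]
  refine card_bij (fun p _ k => p.1 (s k)) ?_ ?_ ?_
  · intro p hp
    rw [mem_filter, hiff] at hp
    exact Fintype.mem_piFinset.mpr fun k => mem_filter.mpr ⟨mem_univ _, hp.2 k⟩
  · intro p _ q _ h
    refine Subtype.ext (funext fun i => ?_)
    simpa using congrFun h (s.symm i)
  · intro g hg
    have hout : HasOutcome s (fun i => g (s.symm i)) := by
      intro k
      simpa using Fintype.mem_piFinset.mp hg k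
    have hpark : IsParkingFunction fun i => g (s.symm i) := fun i =>
      ⟨s.symm i, by rw [(street_eq_iff_hasOutcome s _).mpr hout, s.apply_symm_apply]⟩
    refine ⟨⟨_, hpark⟩, mem_filter.mpr ⟨mem_univ _, (hiff _).mpr hout⟩, ?_⟩
    funext k
    simp

/-- The fibres of `toPerm` partition the parking functions, so the normalising constant is the sum
of the fibre sizes. -/
theorem expectation_eq (n : ℕ) (X : Equiv.Perm (Fin n) → ℝ) :
    parkExpectation n X = (∑ s : Equiv.Perm (Fin n), ((∏ k, prefCount s k : ℕ) : ℝ) * X s) /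
      ∑ s : Equiv.Perm (Fin n), ((∏ k, prefCount s k : ℕ) : ℝ) := by
  have hcard : (Fintype.card (ParkingFunction n) : ℝ) =
      ∑ s : Equiv.Perm (Fin n), ((∏ k, prefCount s k : ℕ) : ℝ) := by
    simp_rw [← card_fiber_toPerm]
    rw [← Nat.cast_sum, ← card_eq_sum_card_fiberwise (fun _ _ => mem_coe.mpr (mem_univ _)),
      card_univ]
  rw [parkExpectation, ← hcard, sum_div]
  refine sum_congr rfl fun s _ => ?_
  have h : (parkPMF n s).toReal = ((∏ k, prefCount s k : ℕ) : ℝ) /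
      Fintype.card (ParkingFunction n) := by
    rw [← card_fiber_toPerm, parkPMF, PMF.map_apply, tsum_fintype]
    simp only [PMF.uniformOfFintype_apply]
    rw [← sum_filter, sum_const, nsmul_eq_mul, ENNReal.toReal_mul, ENNReal.toReal_inv,
      ENNReal.toReal_natCast, ENNReal.toReal_natCast, div_eq_mul_inv]
    simp only [eq_comm]
  rw [h]
  ring

/-! ### From permutations to lists -/

/-- The values of `f`, read from right to left. -/
def revList {α : Type*} {n : ℕ} (f : Fin n → α) : List α := List.ofFn fun k => f k.rev

theorem revList_succ {α : Type*} {n : ℕ} (f : Fin (n + 1) → α) :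
    revList f = f (Fin.last n) :: revList fun k => f k.castSucc := by
  rw [revList, List.ofFn_succ, revList]
  simp [Fin.rev_succ]

theorem mem_revList {α : Type*} {n : ℕ} (f : Fin n → α) (x : α) : x ∈ revList f ↔ ∃ k, f k = x := by
  rw [revList, List.mem_ofFn', Set.mem_range]
  exact ⟨fun ⟨k, h⟩ => ⟨k.rev, h⟩, fun ⟨k, h⟩ => ⟨k.rev, by simpa using h⟩⟩

section Lists

variable {α : Type*} [LinearOrder α]

/-- The top value of `p` is always admissible, vacuously, which gives the `+ 1`; each lower `p` is
admissible as long as the run of entries below `x`, read from the right, reaches down to it. -/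
theorem card_filter_forall_lt {n : ℕ} (g : Fin n → α) (x : α) :
    (univ.filter fun p : Fin (n + 1) => ∀ j : Fin n, p ≤ j.castSucc → g j < x).card =
      ((revList g).takeWhile (· < x)).length + 1 := by
  induction n with
  | zero => simp [revList]
  | succ n ih =>
    rw [revList_succ, List.takeWhile_cons, card_filter, Fin.sum_univ_castSucc]
    have hlast : ∀ j : Fin (n + 1), Fin.last (n + 1) ≤ j.castSucc → g j < x :=
      fun j hj => absurd hj (not_le.mpr (Fin.castSucc_lt_last j))
    rw [if_pos hlast]
    by_cases h : g (Fin.last n) < x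
    · simp only [h, decide_true, if_true, List.length_cons]
      rw [← ih, card_filter]
      congr 1
      refine sum_congr rfl fun p _ => ?_
      congr 1
      rw [eq_iff_iff, Fin.forall_fin_succ']
      simp [h]
    · simp only [h, decide_false]
      rw [sum_eq_zero]
      · simp
      · intro p _
        exact if_neg fun hp => h (hp (Fin.last n) (by simpa using Fin.le_last p))

theorem prefCount_last {n : ℕ} (f : Fin (n + 1) → α) :
    prefCount f (Fin.last n) =
      ((revList fun k => f k.castSucc).takeWhile (· < f (Fin.last n))).length + 1 := by
  rw [← card_filter_forall_lt, prefCount]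
  congr 1
  ext p
  simp [Fin.forall_fin_succ', Fin.le_last]

theorem prefCount_castSucc {n : ℕ} (f : Fin (n + 1) → α) (k : Fin n) :
    prefCount f k.castSucc = prefCount (fun k => f k.castSucc) k := by
  rw [prefCount, prefCount, card_filter, card_filter, Fin.sum_univ_castSucc]
  simp [Fin.forall_fin_succ', (Fin.castSucc_lt_last k).not_ge, (Fin.castSucc_lt_last k).not_gt]

/-- The count at a space looks only to its left, so the last space can be dropped. Allowing any `f`,
not just permutations, keeps the restriction within the induction. -/
theorem prod_prefCount {n : ℕ} (f : Fin n → α) : ∏ k, prefCount f k = weight (revList f) := by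
  induction n with
  | zero => simp [revList, weight]
  | succ n ih =>
    rw [Fin.prod_univ_castSucc, revList_succ, weight, prefCount_last, mul_comm, ← ih]
    simp only [prefCount_castSucc]

theorem card_leftToRightMaxima {n : ℕ} (f : Fin n → α) :
    (univ.filter fun i => ∀ k, k < i → f k < f i).card = recordCount (revList f) := by
  induction n with
  | zero => simp [revList, recordCount]
  | succ n ih =>
    rw [revList_succ, recordCount, ← ih, card_filter, card_filter, Fin.sum_univ_castSucc]
    congr 1
    · simp [Fin.forall_fin_succ', (Fin.castSucc_lt_last _).not_gt]
    · simp [Fin.forall_fin_succ', mem_revList]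

end Lists

theorem lrMax_eq_recordCount {n : ℕ} (s : Equiv.Perm (Fin n)) :
    lrMax s = recordCount (revList s) := by
  rw [← card_leftToRightMaxima, lrMax]
  congr 1

theorem sum_perm_eq_sum_arrangements (n : ℕ) (g : List (Fin n) → ℝ) :
    ∑ s : Equiv.Perm (Fin n), g (revList s) = ∑ w ∈ arrangements (univ : Finset (Fin n)), g w := by
  refine sum_bij (fun s _ => revList s) ?_ ?_ ?_ fun _ _ => rfl
  · intro s _
    rw [mem_arrangements]
    refine ⟨?_, ?_⟩
    · rw [revList, List.nodup_ofFn]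
      exact s.injective.comp Fin.rev_injective
    · ext x
      simpa [mem_revList] using s.surjective x
  · intro s _ t _ h
    ext k
    have := congrFun (List.ofFn_injective h) k.rev
    simp only [Fin.rev_rev] at this
    rw [this]
  · intro w hw
    obtain ⟨hn, hu⟩ := mem_arrangements.mp hw
    have hlen : w.length = n := by
      rw [← List.toFinset_card_of_nodup hn, hu, card_univ, Fintype.card_fin]
    have hinj : Function.Injective fun k : Fin n => w.get (k.rev.cast hlen.symm) :=
      (List.nodup_iff_injective_get.mp hn).comp
        ((Fin.cast_injective hlen.symm).comp Fin.rev_injective)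
    refine ⟨Equiv.ofBijective _ (Finite.injective_iff_bijective.mp hinj), mem_univ _, ?_⟩
    refine List.ext_get (by simp [revList, hlen]) fun i h1 h2 => ?_
    have hi : n - (n - (i + 1) + 1) = i := by omega
    simp [revList, hi]

theorem expectedLRMax_eq_div (n : ℕ) : expectedLRMax n = lrMaxTotal n / cayley n := by
  obtain ⟨h1, h2⟩ := sum_weight_and_recordCount n (univ : Finset (Fin n)) (by simp)
  rw [expectedLRMax, expectation_eq, ← h1, ← h2,
    ← sum_perm_eq_sum_arrangements n fun w => (weight w : ℝ),
    ← sum_perm_eq_sum_arrangements n fun w => (weight w : ℝ) * recordCount w]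
  simp only [prod_prefCount, lrMax_eq_recordCount]

/-! ### The falling factorial ratio and its sums -/

/-- The ratio `n (n - 1) ⋯ (n - l + 1) / (n + 1) ^ l`. -/
def fallRatio (n l : ℕ) : ℝ := (∏ j ∈ range l, ((n : ℝ) - (j : ℝ))) / ((n : ℝ) + 1) ^ l

theorem fallRatio_zero (n : ℕ) : fallRatio n 0 = 1 := by simp [fallRatio]

theorem fallRatio_succ (n l : ℕ) :
    fallRatio n (l + 1) = fallRatio n l * (((n : ℝ) - l) / (n + 1)) := by
  rw [fallRatio, fallRatio, prod_range_succ, pow_succ, mul_div_mul_comm]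

theorem fallRatio_top (n : ℕ) : fallRatio n (n + 1) = 0 := by simp [fallRatio_succ]

/-- The identity `1 - (n - l) / (n + 1) = (l + 1) / (n + 1)`, the source of the telescoping. -/
theorem succ_mul_fallRatio (n l : ℕ) :
    ((l : ℝ) + 1) * fallRatio n l = (n + 1) * (fallRatio n l - fallRatio n (l + 1)) := by
  have : (n : ℝ) + 1 ≠ 0 := by positivity
  rw [fallRatio_succ]
  field_simp
  ring

theorem fallRatio_nonneg {n l : ℕ} (hl : l ≤ n + 1) : 0 ≤ fallRatio n l := by
  refine div_nonneg (prod_nonneg fun j hj => ?_) (by positivity)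
  have : j ≤ n := by have := mem_range.mp hj; omega
  have : (j : ℝ) ≤ n := by exact_mod_cast this
  linarith

theorem fallRatio_le_one {n l : ℕ} (hl : l ≤ n) : fallRatio n l ≤ 1 := by
  induction l with
  | zero => rw [fallRatio_zero]
  | succ l ih =>
    rw [fallRatio_succ]
    have h : (l : ℝ) ≤ n := by exact_mod_cast (by omega : l ≤ n)
    refine mul_le_one₀ (ih (by omega)) (div_nonneg (by linarith) (by positivity)) ?_
    rw [div_le_one (by positivity)]
    have : (0 : ℝ) ≤ l := by positivity
    linarith

/-- Passing from `l` to `l + 1` loses at most `(l + 1) / (n + 1)`, as the ratio is at most `1`; the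
losses add up to a triangular number over `n + 1`. -/
theorem one_sub_le_fallRatio {n l : ℕ} (hl : l ≤ n) :
    1 - (l : ℝ) * (l + 1) / (2 * (n + 1)) ≤ fallRatio n l := by
  induction l with
  | zero => simp [fallRatio_zero]
  | succ l ih =>
    have h1 := ih (by omega)
    have h2 := fallRatio_le_one (n := n) (l := l) (by omega)
    have h3 : fallRatio n (l + 1) = fallRatio n l - fallRatio n l * (((l : ℝ) + 1) / (n + 1)) := by
      have : (n : ℝ) + 1 ≠ 0 := by positivity
      rw [fallRatio_succ]; field_simp; ring
    have h4 : fallRatio n l * (((l : ℝ) + 1) / (n + 1)) ≤ ((l : ℝ) + 1) / (n + 1) :=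
      mul_le_of_le_one_left (by positivity) h2
    have h5 : ((l + 1 : ℕ) : ℝ) * ((l + 1 : ℕ) + 1) / (2 * (n + 1)) =
        (l : ℝ) * (l + 1) / (2 * (n + 1)) + ((l : ℝ) + 1) / (n + 1) := by
      have : (n : ℝ) + 1 ≠ 0 := by positivity
      push_cast; field_simp; ring
    rw [h3, h5]
    linarith

/-- The closed form of the expected number of left-to-right maxima with nonnegative terms. -/
def lrMaxMean (n : ℕ) : ℝ := ∑ l ∈ Icc 1 n, ((l : ℝ) + 1) / l * fallRatio n l

/-- With `r = fallRatio n`, the `l`-th terms of the two sums add to `(n + 1) * (r l / l - r (l + 1)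
/ (l + 1))`. The total is `(n + 1) * r 1 = n` because `r (n + 1) = 0`. -/
theorem lrMaxMean_eq (n : ℕ) :
    lrMaxMean n = (n : ℝ) - ∑ l ∈ Icc 1 n,
      ((n : ℝ) - (l : ℝ)) / ((l : ℝ) * ((l : ℝ) + 1)) * fallRatio n l := by
  have key : ∀ m : ℕ, ∑ l ∈ Icc 1 m, (((l : ℝ) + 1) / l * fallRatio n l +
      ((n : ℝ) - (l : ℝ)) / ((l : ℝ) * ((l : ℝ) + 1)) * fallRatio n l) =
      (n + 1) * (fallRatio n 1 - fallRatio n (m + 1) / (m + 1)) := by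
    intro m
    induction m with
    | zero => simp
    | succ m ih =>
      rw [sum_Icc_succ_top (by omega), ih, fallRatio_succ n (m + 1)]
      have h1 : (n : ℝ) + 1 ≠ 0 := by positivity
      have h2 : (m : ℝ) + 1 ≠ 0 := by positivity
      have h3 : (m : ℝ) + 1 + 1 ≠ 0 := by positivity
      push_cast
      field_simp
      ring
  have h := key n
  have h1 : (n : ℝ) + 1 ≠ 0 := by positivity
  rw [sum_add_distrib, fallRatio_top, fallRatio_succ, fallRatio_zero] at h
  rw [lrMaxMean, eq_sub_iff_add_eq, h]
  field_simp
  simp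

theorem sum_succ_mul_fallRatio (n : ℕ) :
    ∑ l ∈ Icc 1 n, ((l : ℝ) + 1) * fallRatio n l = n := by
  have h1 : (n : ℝ) + 1 ≠ 0 := by positivity
  simp_rw [succ_mul_fallRatio]
  rw [← mul_sum, ← Ico_add_one_right_eq_Icc, ← neg_inj, ← mul_neg, ← sum_neg_distrib]
  simp_rw [neg_sub]
  rw [sum_Ico_sub _ (by omega), fallRatio_top, fallRatio_succ, fallRatio_zero]
  field_simp
  simp

/-! ### Order of magnitude `√n` and the two limits. -/

theorem lrMaxMean_nonneg (n : ℕ) : 0 ≤ lrMaxMean n :=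
  sum_nonneg fun _ hl => mul_nonneg (by positivity)
    (fallRatio_nonneg ((mem_Icc.mp hl).2.trans (Nat.le_succ n)))

/-- Split at `l = √n`. Each earlier term is at most `2`; for a later one `1 ≤ (l + 1) / √n`, so
these are bounded by `2 / √n` times the sum that equals `n`. Each half contributes `2 * √n`. -/
theorem lrMaxMean_le (n : ℕ) : lrMaxMean n ≤ 4 * √n := by
  rcases Nat.eq_zero_or_pos n with rfl | hn
  · simp [lrMaxMean]
  have hs : 0 < √(n : ℝ) := Real.sqrt_pos.mpr (by exact_mod_cast hn)
  have h1 : lrMaxMean n ≤ ∑ l ∈ Icc 1 n,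
      ((if l ≤ Nat.sqrt n then (2 : ℝ) else 0) + 2 / √n * (((l : ℝ) + 1) * fallRatio n l)) := by
    refine sum_le_sum fun l hl => ?_
    obtain ⟨hl1, hl2⟩ := mem_Icc.mp hl
    have h0 := fallRatio_nonneg (n := n) (l := l) (by omega)
    have hl1' : (1 : ℝ) ≤ l := by exact_mod_cast hl1
    have h2 : ((l : ℝ) + 1) / l ≤ 2 := by rw [div_le_iff₀ (by linarith)]; linarith
    have h3 : ((l : ℝ) + 1) / l * fallRatio n l ≤ 2 * fallRatio n l :=
      mul_le_mul_of_nonneg_right h2 h0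
    split_ifs with h
    · have h4 := fallRatio_le_one hl2
      have : 0 ≤ 2 / √(n : ℝ) * (((l : ℝ) + 1) * fallRatio n l) := by positivity
      linarith
    · have h5 : √(n : ℝ) ≤ l + 1 := by
        rw [Real.sqrt_le_left (by positivity)]
        have h6 : n < l * l := Nat.sqrt_lt.mp (not_le.mp h)
        have h7 : (n : ℝ) < l * l := by exact_mod_cast h6
        nlinarith
      have h8 : 2 * fallRatio n l ≤ 2 / √(n : ℝ) * (((l : ℝ) + 1) * fallRatio n l) := by
        rw [div_mul_eq_mul_div, le_div_iff₀ hs]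
        nlinarith [mul_le_mul_of_nonneg_left h5 h0]
      linarith
  refine h1.trans ?_
  rw [sum_add_distrib, ← mul_sum, sum_succ_mul_fallRatio, ← sum_filter, sum_const, nsmul_eq_mul]
  have h9 : ((Icc 1 n).filter (· ≤ Nat.sqrt n)).card ≤ Nat.sqrt n := by
    calc _ ≤ (Icc 1 (Nat.sqrt n)).card := card_le_card fun l hl => by
          rw [mem_filter, mem_Icc] at hl; exact mem_Icc.mpr ⟨hl.1.1, hl.2⟩
      _ = _ := by simp
  have h10 : (((Icc 1 n).filter (· ≤ Nat.sqrt n)).card : ℝ) ≤ √n :=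
    (Nat.cast_le.mpr h9).trans (Real.nat_sqrt_le_real_sqrt)
  have h11 : 2 / √(n : ℝ) * n = 2 * √n := by
    rw [div_mul_eq_mul_div, mul_div_assoc, Real.div_sqrt]
  linarith

/-- Each of the first `Nat.sqrt n` terms is at least `1 / 4`, and `Nat.sqrt n ≥ √n / 2`. -/
theorem le_lrMaxMean {n : ℕ} (hn : 1 ≤ n) : √n / 8 ≤ lrMaxMean n := by
  have hs1 : 1 ≤ Nat.sqrt n := Nat.sqrt_pos.mpr hn
  have hsn : Nat.sqrt n ≤ n := Nat.sqrt_le_self n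
  have hs : √(n : ℝ) ≤ 2 * Nat.sqrt n := by
    have h1 := Real.real_sqrt_le_nat_sqrt_succ (a := n)
    have h2 : (1 : ℝ) ≤ Nat.sqrt n := by exact_mod_cast hs1
    linarith
  have hterm : ∀ l ∈ Icc 1 (Nat.sqrt n), (1 : ℝ) / 4 ≤ ((l : ℝ) + 1) / l * fallRatio n l := by
    intro l hl
    obtain ⟨hl1, hl2⟩ := mem_Icc.mp hl
    have hl1' : (1 : ℝ) ≤ l := by exact_mod_cast hl1
    have h1 := one_sub_le_fallRatio (hl2.trans hsn)
    have h2 : (l : ℝ) * l ≤ n := by exact_mod_cast Nat.le_sqrt.mp hl2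
    -- From `l ≤ (l ^ 2 + 1) / 2` and `l ^ 2 ≤ n`, the product `l * (l + 1)` is at most `(3 * n + 1)
    -- / 2`.
    have h3 : (l : ℝ) * (l + 1) / (2 * (n + 1)) ≤ 3 / 4 := by
      rw [div_le_iff₀ (by positivity)]
      nlinarith [sq_nonneg ((l : ℝ) - 1)]
    have h4 : 1 ≤ ((l : ℝ) + 1) / l := by rw [le_div_iff₀ (by linarith)]; linarith
    nlinarith
  calc √(n : ℝ) / 8 ≤ ∑ l ∈ Icc 1 (Nat.sqrt n), (1 : ℝ) / 4 := by
        rw [sum_const, Nat.card_Icc, nsmul_eq_mul, Nat.add_sub_cancel]; linarith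
    _ ≤ ∑ l ∈ Icc 1 (Nat.sqrt n), ((l : ℝ) + 1) / l * fallRatio n l := sum_le_sum hterm
    _ ≤ lrMaxMean n := by
        refine sum_le_sum_of_subset_of_nonneg (Icc_subset_Icc_right hsn) fun l hl _ => ?_
        exact mul_nonneg (by positivity) (fallRatio_nonneg ((mem_Icc.mp hl).2.trans (Nat.le_succ n)))

/-- The quotient is nonnegative and eventually at most `4 * n ^ (-ε)`, so it actually converges to
`0`. -/
theorem limsup_lrMaxMean (ε : ℝ) (hε : 0 < ε) :
    Filter.limsup (fun n : ℕ => ((lrMaxMean n / (n : ℝ) ^ ((1 : ℝ) / 2 + ε) : ℝ) : EReal))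
      Filter.atTop = 0 := by
  refine Filter.Tendsto.limsup_eq ?_
  rw [← EReal.coe_zero]
  refine (continuous_coe_real_ereal.tendsto 0).comp ?_
  have hlim : Filter.Tendsto (fun n : ℕ => 4 * (n : ℝ) ^ (-ε)) Filter.atTop (nhds 0) := by
    simpa using ((tendsto_rpow_neg_atTop hε).comp tendsto_natCast_atTop_atTop).const_mul 4
  refine tendsto_of_tendsto_of_tendsto_of_le_of_le' tendsto_const_nhds hlim
    (Filter.Eventually.of_forall fun n => div_nonneg (lrMaxMean_nonneg n) (by positivity)) ?_
  filter_upwards [Filter.eventually_ge_atTop 1] with n hn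
  have hn' : (0 : ℝ) < n := by exact_mod_cast hn
  rw [div_le_iff₀ (by positivity), mul_assoc, ← Real.rpow_add hn']
  have : -ε + (1 / 2 + ε) = 1 / 2 := by ring
  rw [this, ← Real.sqrt_eq_rpow]
  exact lrMaxMean_le n

theorem liminf_lrMaxMean :
    0 < Filter.liminf (fun n : ℕ => ((lrMaxMean n / (n : ℝ) ^ ((1 : ℝ) / 2) : ℝ) : EReal))
      Filter.atTop := by
  have h : ((1 / 8 : ℝ) : EReal) ≤ Filter.liminf
      (fun n : ℕ => ((lrMaxMean n / (n : ℝ) ^ ((1 : ℝ) / 2) : ℝ) : EReal)) Filter.atTop := by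
    refine Filter.le_liminf_of_le (by isBoundedDefault) ?_
    filter_upwards [Filter.eventually_ge_atTop 1] with n hn
    have hn' : (0 : ℝ) < n := by exact_mod_cast hn
    rw [EReal.coe_le_coe_iff, le_div_iff₀ (by positivity), ← Real.sqrt_eq_rpow]
    linarith [le_lrMaxMean hn]
  refine lt_of_lt_of_le ?_ h
  rw [← EReal.coe_zero, EReal.coe_lt_coe_iff]
  norm_num

/-! ### The expected number of left-to-right maxima -/

theorem prod_range_sub_eq_descFactorial (n l : ℕ) :
    ∏ j ∈ range l, ((n : ℝ) - (j : ℝ)) = n.descFactorial l := by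
  induction l with
  | zero => simp
  | succ l ih =>
    rw [prod_range_succ, ih, Nat.descFactorial_succ]
    rcases le_or_gt l n with h | h
    · push_cast [Nat.cast_sub h]; ring
    · simp [Nat.descFactorial_of_lt h]

/-- Since `(n + 1) * cayley n = (n + 1) ^ n`, dividing by `cayley n` turns `(n + 1) ^ (n - l) / (n +
1)` into `(n + 1) ^ (-l)`. -/
theorem expectedLRMax_eq (n : ℕ) : expectedLRMax n = lrMaxMean n := by
  have hn : (n : ℝ) + 1 ≠ 0 := by positivity
  rw [expectedLRMax_eq_div, div_eq_iff (cayley_pos n).ne', lrMaxMean, lrMaxTotal, sum_mul]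
  refine sum_congr rfl fun l hl => ?_
  have h := succ_mul_cayley n
  rw [← Nat.sub_add_cancel (mem_Icc.mp hl).2, pow_add, Nat.sub_add_cancel (mem_Icc.mp hl).2] at h
  rw [fallRatio, prod_range_sub_eq_descFactorial]
  have hl0 : (l : ℝ) ≠ 0 := Nat.cast_ne_zero.mpr (by have := (mem_Icc.mp hl).1; omega)
  field_simp
  linear_combination -(n.descFactorial l : ℝ) * h

end Parking

end

theorem theorem1p15 :
    (∀ n : ℕ, 1 ≤ n →
      Parking.expectedLRMax n =
        (n : ℝ) - ∑ l ∈ Finset.Icc 1 n,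
          ((n : ℝ) - (l : ℝ)) / ((l : ℝ) * ((l : ℝ) + 1)) *
            ((∏ j ∈ Finset.range l, ((n : ℝ) - (j : ℝ))) / ((n : ℝ) + 1) ^ l)) ∧
    (∀ ε : ℝ, 0 < ε →
      Filter.limsup
        (fun n : ℕ => ((Parking.expectedLRMax n / (n : ℝ) ^ ((1 : ℝ) / 2 + ε) : ℝ) : EReal))
        Filter.atTop = 0) ∧
    0 < Filter.liminf
      (fun n : ℕ => ((Parking.expectedLRMax n / (n : ℝ) ^ ((1 : ℝ) / 2) : ℝ) : EReal))
      Filter.atTop := by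
  refine ⟨fun n _ => ?_, ?_⟩
  · rw [Parking.expectedLRMax_eq, Parking.lrMaxMean_eq]
    rfl
  · simp only [Parking.expectedLRMax_eq]
    exact ⟨Parking.limsup_lrMaxMean, Parking.liminf_lrMaxMean⟩
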